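/- For an integer $k\ge 2$ and vectors $g=(g_1,\dots,g_k)$, $f=(f_1,\dots,f_k)$ of real numbers let $$\psi(g,f)=\sum_{\sigma\in S_k} g_{\sigma(1)}g_{\sigma(2)}\cdots g_{\sigma(k-2)}\,f_{\sigma(k-1)},$$ where $S_k$ is the group of permutations of $\{1,\dots,k\}$, and let $\Psi(p;q)=\psi(p,q)+\psi(q,p)$, where $p=(p_1,\dots,p_k)$ and $q=(q_1,\dots,q_k)$ range over the probability vectors of length $k$ (nonnegative coordinates with sum $1$). Then: (1) For $k=5$ the global maximum of $\Psi$ is $\frac{15(48+\sqrt5)}{1936}\approx 0.389226$ (rounded to six decimals), and it is attained at the pair of probability vectors $p=(0,\tfrac14,\tfrac14,\tfrac14,\tfrac14)$, $q=(\gamma,\delta,\delta,\delta,\delta)$ with $\delta=\frac{4+\sqrt5}{44}$ and $\gamma=1-4\delta$. (2) For $k=6$ the global maximum of $\Psi$ is $\frac{24}{125}=0.192$, and it is attained at the pair of probability vectors $p=(1,0,0,0,0,0)$, $q=(0,\tfrac15,\tfrac15,\tfrac15,\tfrac15,\tfrac15)$. -/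

import Mathlib

/-- `ψ(g,f) = ∑_{σ ∈ S_k} g_{σ(1)} ⋯ g_{σ(k-2)} f_{σ(k-1)}` for vectors of length `k = m + 2`.
With indices starting at `0`, the positions `1, …, k-2` are the first `m` elements of
`Fin (m + 2)`, and the position `k-1` is the element of value `m`. -/
def psi {m : ℕ} (g f : Fin (m + 2) → ℝ) : ℝ :=
  ∑ σ : Equiv.Perm (Fin (m + 2)),
    (∏ i : Fin m, g (σ (Fin.castAdd 2 i))) * f (σ (Fin.natAdd m 0))

/-- `Ψ(p;q) = ψ(p,q) + ψ(q,p)`. -/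
def bigPsi {m : ℕ} (p q : Fin (m + 2) → ℝ) : ℝ :=
  psi p q + psi q p

/-- The set of values of `Ψ` over pairs of probability vectors of length `k = m + 2`. -/
def bigPsiValues (m : ℕ) : Set ℝ :=
  {x | ∃ p ∈ stdSimplex ℝ (Fin (m + 2)), ∃ q ∈ stdSimplex ℝ (Fin (m + 2)), bigPsi p q = x}

/-!
The matrix with rows `(g l, …, g l, f l, 1)` has permanent `ψ(g,f)`, and a permanent is a symmetric
bilinear form in any two of its rows. Interpolating linearly from `(p,q)` to the pair obtained by
exchanging the coordinates `i` and `j` therefore changes `Ψ` by `t (1 - t) D`, where `D ≥ 0` as soon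
as `p` and `q` do not order `i` and `j` strictly oppositely. Among the maximizers of `Ψ`, take one
for which `∑ p² + ∑ q²` is least. If `D ≥ 0`, passing to `t = 1 / 2` shows that the coordinates `i`
and `j` agree; if all four entries involved are positive, `t` may be slightly negative, which
excludes `D < 0`. So all coordinates with both entries nonzero agree, and after a permutation `p`
and `q` are step vectors `(0, …, w, …, u, …)` and `(v, …, z, …, 0, …)` with common blocks. For
`k = 5, 6` this leaves finitely many polynomial inequalities; after substituting `u = w + t` and
`v = z + s` most of them only involve nonnegative coefficients.
-/

section PermanentRows

open Matrix

variable {ι R : Type*} [Fintype ι] [DecidableEq ι] [CommRing R]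

/-- The permanent of `M` as a symmetric bilinear form in the rows `i` and `j`, the actual entries
of `M` in these two rows being ignored. -/
def rowPairForm (M : Matrix ι ι R) (i j : ι) : LinearMap.BilinForm R (ι → R) :=
  ∑ σ : Equiv.Perm ι, (∏ l ∈ {i, j}ᶜ, M l (σ l)) •
    LinearMap.BilinForm.linMulLin (LinearMap.proj (σ i)) (LinearMap.proj (σ j))

theorem rowPairForm_apply (M : Matrix ι ι R) (i j : ι) (c d : ι → R) :
    rowPairForm M i j c d =
      ∑ σ : Equiv.Perm ι, (∏ l ∈ {i, j}ᶜ, M l (σ l)) * (c (σ i) * d (σ j)) := by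
  simp [rowPairForm]

theorem permanent_eq_rowPairForm (M : Matrix ι ι R) {i j : ι} (hij : i ≠ j) :
    M.permanent = rowPairForm M i j (M i) (M j) := by
  rw [← permanent_transpose, permanent, rowPairForm_apply]
  refine Finset.sum_congr rfl fun σ _ => ?_
  rw [← Finset.prod_compl_mul_prod {i, j}, Finset.prod_pair hij]
  rfl

theorem rowPairForm_congr {M N : Matrix ι ι R} {i j : ι} (h : ∀ l, l ≠ i → l ≠ j → M l = N l) :
    rowPairForm M i j = rowPairForm N i j := by
  refine Finset.sum_congr rfl fun σ _ => ?_
  congr 1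
  refine Finset.prod_congr rfl fun l hl => ?_
  simp only [Finset.mem_compl, Finset.mem_insert, Finset.mem_singleton, not_or] at hl
  rw [h l hl.1 hl.2]

theorem rowPairForm_comm (M : Matrix ι ι R) (i j : ι) (c d : ι → R) :
    rowPairForm M i j c d = rowPairForm M i j d c := by
  simp only [rowPairForm_apply]
  rw [← Equiv.sum_comp (Equiv.mulRight (Equiv.swap i j))]
  refine Finset.sum_congr rfl fun σ _ => ?_
  congr 1
  · refine Finset.prod_congr rfl fun l hl => ?_
    simp only [Finset.mem_compl, Finset.mem_insert, Finset.mem_singleton, not_or] at hl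
    simp [Equiv.swap_apply_of_ne_of_ne hl.1 hl.2]
  · simp [mul_comm]

theorem rowPairForm_lineMap (M : Matrix ι ι R) (i j : ι) (c d : ι → R) (t : R) :
    rowPairForm M i j (AffineMap.lineMap c d t) (AffineMap.lineMap d c t) =
      rowPairForm M i j c d + t * (1 - t) * rowPairForm M i j (c - d) (c - d) := by
  simp only [AffineMap.lineMap_apply_module', map_add, map_sub, map_smul, LinearMap.add_apply,
    LinearMap.sub_apply, LinearMap.smul_apply, smul_eq_mul, rowPairForm_comm M i j d c]
  ring

theorem rowPairForm_single_single_self (M : Matrix ι ι R) {i j : ι} (hij : i ≠ j) (a : ι) :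
    rowPairForm M i j (Pi.single a 1) (Pi.single a 1) = 0 := by
  rw [rowPairForm_apply]
  refine Finset.sum_eq_zero fun σ _ => ?_
  by_cases hi : σ i = a
  · have hj : σ j ≠ a := fun hj => hij (σ.injective (hi.trans hj.symm))
    simp [hj]
  · simp [hi]

theorem rowPairForm_nonneg [PartialOrder R] [IsOrderedRing R] {M : Matrix ι ι R} {i j : ι}
    {c d : ι → R} (hM : ∀ l a, 0 ≤ M l a) (hc : ∀ a, 0 ≤ c a) (hd : ∀ a, 0 ≤ d a) :
    0 ≤ rowPairForm M i j c d := by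
  rw [rowPairForm_apply]
  exact Finset.sum_nonneg fun σ _ =>
    mul_nonneg (Finset.prod_nonneg fun l _ => hM l _) (mul_nonneg (hc _) (hd _))

end PermanentRows

section Psi

variable {m : ℕ}

/-- The square matrix with rows `(g l, …, g l, f l, 1)`, whose permanent is `ψ(g,f)`. -/
def psiMatrix (g f : Fin (m + 2) → ℝ) : Matrix (Fin (m + 2)) (Fin (m + 2)) ℝ :=
  Matrix.of fun l => Fin.append (fun _ => g l) ![f l, 1]

theorem psi_eq_permanent (g f : Fin (m + 2) → ℝ) : psi g f = (psiMatrix g f).permanent := by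
  refine Finset.sum_congr rfl fun σ _ => ?_
  rw [Fin.prod_univ_add, Fin.prod_univ_two]
  simp [psiMatrix]

theorem psiMatrix_nonneg {g f : Fin (m + 2) → ℝ} (hg : ∀ l, 0 ≤ g l) (hf : ∀ l, 0 ≤ f l)
    (l a : Fin (m + 2)) : 0 ≤ psiMatrix g f l a := by
  refine Fin.addCases (fun b => ?_) (fun b => ?_) a
  · simpa [psiMatrix] using hg l
  · fin_cases b <;> simp [psiMatrix, hf l]

theorem psiMatrix_sub (g f : Fin (m + 2) → ℝ) (i j : Fin (m + 2)) :
    psiMatrix g f i - psiMatrix g f j =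
      (g i - g j) • Fin.append (1 : Fin m → ℝ) 0 + (f i - f j) • Pi.single (Fin.natAdd m 0) 1 := by
  ext a
  refine Fin.addCases (fun b => ?_) (fun b => ?_) a
  · have hb : Fin.castAdd 2 b ≠ Fin.natAdd m 0 := by
      rw [ne_eq, Fin.ext_iff, Fin.val_castAdd, Fin.val_natAdd]
      omega
    simp [psiMatrix, hb]
  · fin_cases b <;> simp [psiMatrix]

theorem psiMatrix_lineMap_comp (g f : Fin (m + 2) → ℝ) (τ : Equiv.Perm (Fin (m + 2))) (t : ℝ)
    (l : Fin (m + 2)) :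
    psiMatrix (AffineMap.lineMap g (g ∘ τ) t) (AffineMap.lineMap f (f ∘ τ) t) l =
      AffineMap.lineMap (psiMatrix g f l) (psiMatrix g f (τ l)) t := by
  ext a
  refine Fin.addCases (fun b => ?_) (fun b => ?_) a
  · simp [psiMatrix, AffineMap.lineMap_apply_module']
  · fin_cases b <;> simp [psiMatrix, AffineMap.lineMap_apply_module']

/-- The form `rowPairForm` of `psiMatrix g f`, evaluated on the difference of the rows `i`, `j`. It
measures how `ψ` changes when `g` and `f` move towards their copies with coordinates `i`, `j`
exchanged. -/
def swapDefect (g f : Fin (m + 2) → ℝ) (i j : Fin (m + 2)) : ℝ :=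
  rowPairForm (psiMatrix g f) i j (psiMatrix g f i - psiMatrix g f j)
    (psiMatrix g f i - psiMatrix g f j)

theorem psi_lineMap_comp_swap (g f : Fin (m + 2) → ℝ) {i j : Fin (m + 2)} (hij : i ≠ j) (t : ℝ) :
    psi (AffineMap.lineMap g (g ∘ Equiv.swap i j) t) (AffineMap.lineMap f (f ∘ Equiv.swap i j) t) =
      psi g f + t * (1 - t) * swapDefect g f i j := by
  have hrow := psiMatrix_lineMap_comp g f (Equiv.swap i j) t
  rw [psi_eq_permanent, psi_eq_permanent, permanent_eq_rowPairForm _ hij,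
    permanent_eq_rowPairForm _ hij, hrow, hrow, Equiv.swap_apply_left, Equiv.swap_apply_right,
    rowPairForm_congr (N := psiMatrix g f), rowPairForm_lineMap, swapDefect]
  intro l hli hlj
  rw [hrow, Equiv.swap_apply_of_ne_of_ne hli hlj, AffineMap.lineMap_same_apply]

theorem swapDefect_nonneg {g f : Fin (m + 2) → ℝ} (hg : ∀ l, 0 ≤ g l) (hf : ∀ l, 0 ≤ f l)
    {i j : Fin (m + 2)} (hij : i ≠ j) (h : 0 ≤ (g i - g j) * (f i - f j)) :
    0 ≤ swapDefect g f i j := by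
  let B := rowPairForm (psiMatrix g f) i j
  let u : Fin (m + 2) → ℝ := Fin.append (1 : Fin m → ℝ) 0
  let e : Fin (m + 2) → ℝ := Pi.single (Fin.natAdd m 0) 1
  have hM := psiMatrix_nonneg hg hf
  have hu : ∀ a, 0 ≤ u a := fun a => Fin.addCases (by simp [u]) (by simp [u]) a
  have he : 0 ≤ e := Pi.single_nonneg.2 zero_le_one
  have huu : 0 ≤ B u u := rowPairForm_nonneg hM hu hu
  have hue : 0 ≤ B u e := rowPairForm_nonneg hM hu he
  have heu : B e u = B u e := rowPairForm_comm _ _ _ _ _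
  have hee : B e e = 0 := rowPairForm_single_single_self _ hij _
  calc 0 ≤ (g i - g j) ^ 2 * B u u + 2 * ((g i - g j) * (f i - f j)) * B u e := by positivity
    _ = B ((g i - g j) • u + (f i - f j) • e) ((g i - g j) • u + (f i - f j) • e) := by
      simp only [map_add, map_smul, LinearMap.add_apply, LinearMap.smul_apply, smul_eq_mul,
        heu, hee]
      ring
    _ = swapDefect g f i j := by rw [swapDefect, psiMatrix_sub]

end Psi

section Smoothing

theorem sum_sq_lineMap_comp_perm {ι : Type*} [Fintype ι] (r : ι → ℝ) (τ : Equiv.Perm ι) :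
    ∑ l, AffineMap.lineMap r (r ∘ τ) (1 / 2 : ℝ) l ^ 2 =
      ∑ l, r l ^ 2 - (∑ l, (r l - r (τ l)) ^ 2) / 4 := by
  have hl (l : ι) : AffineMap.lineMap r (r ∘ τ) (1 / 2 : ℝ) l ^ 2 =
      r l ^ 2 / 2 + r (τ l) ^ 2 / 2 - (r l - r (τ l)) ^ 2 / 4 := by
    simp only [AffineMap.lineMap_apply_module', Pi.add_apply, Pi.smul_apply, Pi.sub_apply,
      Function.comp_apply, smul_eq_mul]
    ring
  simp only [hl, Finset.sum_sub_distrib, Finset.sum_add_distrib, ← Finset.sum_div,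
    Equiv.sum_comp τ fun l => r l ^ 2]
  ring

theorem comp_perm_mem_stdSimplex {ι : Type*} [Fintype ι] {r : ι → ℝ} (hr : r ∈ stdSimplex ℝ ι)
    (τ : Equiv.Perm ι) : r ∘ τ ∈ stdSimplex ℝ ι :=
  ⟨fun l => hr.1 (τ l), (Equiv.sum_comp τ r).trans hr.2⟩

open Filter Topology in
theorem eventually_lineMap_comp_swap_mem_stdSimplex {ι : Type*} [Fintype ι] [DecidableEq ι]
    {r : ι → ℝ} (hr : r ∈ stdSimplex ℝ ι) {i j : ι} (hi : 0 < r i) (hj : 0 < r j) :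
    ∀ᶠ t in 𝓝 (0 : ℝ), AffineMap.lineMap r (r ∘ Equiv.swap i j) t ∈ stdSimplex ℝ ι := by
  let γ : ℝ → ι → ℝ := AffineMap.lineMap r (r ∘ Equiv.swap i j)
  have hγ (t : ℝ) (l : ι) : γ t l = t * (r (Equiv.swap i j l) - r l) + r l := by
    simp [γ, AffineMap.lineMap_apply_module']
  have hpos (l : ι) (hl : 0 < r l) : ∀ᶠ t in 𝓝 (0 : ℝ), 0 ≤ γ t l := by
    have hcont : Continuous fun t => γ t l := by simp only [hγ]; fun_prop
    filter_upwards [hcont.continuousAt.eventually (lt_mem_nhds (by simpa [hγ] using hl))]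
      with t ht using ht.le
  filter_upwards [hpos i hi, hpos j hj] with t hti htj
  refine ⟨fun l => ?_, ?_⟩
  · change 0 ≤ γ t l
    rcases eq_or_ne l i with rfl | hli
    · exact hti
    rcases eq_or_ne l j with rfl | hlj
    · exact htj
    simpa [hγ, Equiv.swap_apply_of_ne_of_ne hli hlj] using hr.1 l
  · change ∑ l, γ t l = 1
    simp only [hγ, Finset.sum_add_distrib, ← Finset.mul_sum, Finset.sum_sub_distrib,
      Equiv.sum_comp, sub_self, mul_zero, hr.2, zero_add]

theorem exists_isMaxOn_forall_eq_le {X : Type*} [TopologicalSpace X] {K : Set X}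
    (hK : IsCompact K) (hne : K.Nonempty) {F E : X → ℝ} (hF : Continuous F) (hE : Continuous E) :
    ∃ x ∈ K, IsMaxOn F K x ∧ ∀ y ∈ K, F y = F x → E x ≤ E y := by
  obtain ⟨x₀, hx₀, hmax⟩ := hK.exists_isMaxOn hne hF.continuousOn
  obtain ⟨x, ⟨hx, hFx⟩, hmin⟩ := (hK.inter_right (isClosed_eq hF continuous_const)).exists_isMinOn
    (⟨x₀, hx₀, rfl⟩ : (K ∩ {x | F x = F x₀}).Nonempty) hE.continuousOn
  refine ⟨x, hx, fun y hy => (hmax hy).trans_eq (Eq.symm hFx), fun y hy hFy => ?_⟩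
  exact hmin ⟨hy, hFy.trans hFx⟩

variable {m : ℕ}

theorem bigPsi_comm (p q : Fin (m + 2) → ℝ) : bigPsi p q = bigPsi q p :=
  add_comm _ _

theorem continuous_bigPsi :
    Continuous fun z : (Fin (m + 2) → ℝ) × (Fin (m + 2) → ℝ) => bigPsi z.1 z.2 := by
  unfold bigPsi psi
  fun_prop

theorem bigPsi_lineMap_comp_swap (p q : Fin (m + 2) → ℝ) {i j : Fin (m + 2)} (hij : i ≠ j)
    (t : ℝ) :
    bigPsi (AffineMap.lineMap p (p ∘ Equiv.swap i j) t)
        (AffineMap.lineMap q (q ∘ Equiv.swap i j) t) =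
      bigPsi p q + t * (1 - t) * (swapDefect p q i j + swapDefect q p i j) := by
  rw [bigPsi, bigPsi, psi_lineMap_comp_swap p q hij, psi_lineMap_comp_swap q p hij]
  ring

/-- Any two coordinates either agree in both vectors, or are strictly ordered in opposite ways
by the two vectors while one of the four entries vanishes. This is what survives at a maximizer of
`Ψ` that cannot be smoothed any further. -/
def CoordBalanced {ι : Type*} (p q : ι → ℝ) : Prop :=
  ∀ i j, (p i = p j ∧ q i = q j) ∨
    ((p i - p j) * (q i - q j) < 0 ∧ (p i = 0 ∨ p j = 0 ∨ q i = 0 ∨ q j = 0))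

/-- The pairs of probability vectors. -/
abbrev simplexPairs (ι : Type*) [Fintype ι] : Set ((ι → ℝ) × (ι → ℝ)) :=
  stdSimplex ℝ ι ×ˢ stdSimplex ℝ ι

theorem swapDefect_add_nonneg_of_isMaxOn {p q : Fin (m + 2) → ℝ}
    (hp : p ∈ stdSimplex ℝ (Fin (m + 2))) (hq : q ∈ stdSimplex ℝ (Fin (m + 2)))
    (hmax : IsMaxOn (fun z => bigPsi z.1 z.2) (simplexPairs (Fin (m + 2))) (p, q))
    {i j : Fin (m + 2)} (hij : i ≠ j)
    (hpi : 0 < p i) (hpj : 0 < p j) (hqi : 0 < q i) (hqj : 0 < q j) :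
    0 ≤ swapDefect p q i j + swapDefect q p i j := by
  -- A small negative `t` stays in the simplices because all four entries are positive.
  obtain ⟨t, ⟨hpt, hqt⟩, ht⟩ := (((eventually_lineMap_comp_swap_mem_stdSimplex hp hpi hpj).and
    (eventually_lineMap_comp_swap_mem_stdSimplex hq hqi hqj)).filter_mono
      nhdsWithin_le_nhds |>.and (self_mem_nhdsWithin (s := Set.Iio 0))).exists
  have hle := isMaxOn_iff.1 hmax (_, _) ⟨hpt, hqt⟩
  simp only [bigPsi_lineMap_comp_swap p q hij] at hle
  have ht0 : t < 0 := ht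
  have : t * (1 - t) < 0 := mul_neg_of_neg_of_pos ht0 (by linarith)
  by_contra! hD
  linarith [mul_pos_of_neg_of_neg this hD]

theorem apply_eq_of_isMaxOn_of_sum_sq_le {p q : Fin (m + 2) → ℝ}
    (hp : p ∈ stdSimplex ℝ (Fin (m + 2))) (hq : q ∈ stdSimplex ℝ (Fin (m + 2)))
    (hmax : IsMaxOn (fun z => bigPsi z.1 z.2) (simplexPairs (Fin (m + 2))) (p, q))
    (hmin : ∀ z ∈ simplexPairs (Fin (m + 2)), bigPsi z.1 z.2 = bigPsi p q →
      ∑ l, p l ^ 2 + ∑ l, q l ^ 2 ≤ ∑ l, z.1 l ^ 2 + ∑ l, z.2 l ^ 2)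
    {i j : Fin (m + 2)} (hij : i ≠ j) (hD : 0 ≤ swapDefect p q i j + swapDefect q p i j) :
    p i = p j ∧ q i = q j := by
  let z : (Fin (m + 2) → ℝ) × (Fin (m + 2) → ℝ) :=
    (AffineMap.lineMap p (p ∘ Equiv.swap i j) (1 / 2 : ℝ),
      AffineMap.lineMap q (q ∘ Equiv.swap i j) (1 / 2 : ℝ))
  have hz : z ∈ simplexPairs (Fin (m + 2)) := by
    constructor <;> refine (convex_stdSimplex ℝ _).lineMap_mem ?_ ?_ (by norm_num) <;>
      simp only [hp, hq, comp_perm_mem_stdSimplex]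
  have hval : bigPsi z.1 z.2 = bigPsi p q := by
    refine le_antisymm (isMaxOn_iff.1 hmax z hz) ?_
    rw [bigPsi_lineMap_comp_swap p q hij]
    linarith
  have hle := hmin z hz hval
  simp only [z, sum_sq_lineMap_comp_perm] at hle
  have hsq (r : Fin (m + 2) → ℝ) : (r i - r j) ^ 2 ≤ ∑ l, (r l - r (Equiv.swap i j l)) ^ 2 := by
    simpa using Finset.single_le_sum (f := fun l => (r l - r (Equiv.swap i j l)) ^ 2)
      (fun l _ => sq_nonneg _) (Finset.mem_univ i)
  constructor <;> rw [← sub_eq_zero, ← sq_nonpos_iff] <;>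
    linarith [hsq p, hsq q, sq_nonneg (p i - p j), sq_nonneg (q i - q j)]

theorem exists_isMaxOn_bigPsi_coordBalanced (m : ℕ) :
    ∃ p ∈ stdSimplex ℝ (Fin (m + 2)), ∃ q ∈ stdSimplex ℝ (Fin (m + 2)), CoordBalanced p q ∧
      IsMaxOn (fun z => bigPsi z.1 z.2) (simplexPairs (Fin (m + 2))) (p, q) := by
  have hcompact := isCompact_stdSimplex ℝ (Fin (m + 2))
  have hne : (stdSimplex ℝ (Fin (m + 2))).Nonempty := ⟨_, single_mem_stdSimplex ℝ 0⟩
  obtain ⟨⟨p, q⟩, ⟨hp, hq⟩, hmax, hmin⟩ := exists_isMaxOn_forall_eq_le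
    (hcompact.prod hcompact) (hne.prod hne) (continuous_bigPsi (m := m))
    (E := fun z => ∑ l, z.1 l ^ 2 + ∑ l, z.2 l ^ 2) (by fun_prop)
  refine ⟨p, hp, q, hq, fun i j => ?_, hmax⟩
  rcases eq_or_ne i j with rfl | hij
  · exact .inl ⟨rfl, rfl⟩
  by_cases hD : 0 ≤ swapDefect p q i j + swapDefect q p i j
  · exact .inl (apply_eq_of_isMaxOn_of_sum_sq_le hp hq hmax hmin hij hD)
  refine .inr ⟨?_, ?_⟩ <;> contrapose! hD
  · exact add_nonneg (swapDefect_nonneg hp.1 hq.1 hij hD)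
      (swapDefect_nonneg hq.1 hp.1 hij (by rwa [mul_comm]))
  · obtain ⟨hpi, hpj, hqi, hqj⟩ := hD
    exact swapDefect_add_nonneg_of_isMaxOn hp hq hmax hij ((hp.1 i).lt_of_ne' hpi)
      ((hp.1 j).lt_of_ne' hpj) ((hq.1 i).lt_of_ne' hqi) ((hq.1 j).lt_of_ne' hqj)

end Smoothing

section PairSum

open scoped Nat

theorem offDiag_card_nsmul_sum_perm {α M : Type*} [Fintype α] [DecidableEq α] [AddCommMonoid M]
    (h : α → α → M) {a b : α} (hab : a ≠ b) :
    (Finset.univ : Finset α).offDiag.card • ∑ σ : Equiv.Perm α, h (σ a) (σ b) =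
      (Fintype.card α)! • ∑ x ∈ (Finset.univ : Finset α).offDiag, h x.1 x.2 := by
  have htrans : ∀ x ∈ (Finset.univ : Finset α).offDiag,
      ∑ σ : Equiv.Perm α, h (σ x.1) (σ x.2) = ∑ σ : Equiv.Perm α, h (σ a) (σ b) := by
    intro x hx
    obtain ⟨τ, hτa, hτb⟩ := MulAction.is_two_pretransitive_iff.1
      (Equiv.Perm.isMultiplyPretransitive α 2) hab (Finset.mem_offDiag.1 hx).2.2
    rw [← hτa, ← hτb]
    exact Equiv.sum_comp (Equiv.mulRight τ) fun σ : Equiv.Perm α => h (σ a) (σ b)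
  have hreindex (σ : Equiv.Perm α) :
      ∑ x ∈ (Finset.univ : Finset α).offDiag, h (σ x.1) (σ x.2) =
        ∑ x ∈ (Finset.univ : Finset α).offDiag, h x.1 x.2 :=
    Finset.sum_equiv (σ.prodCongr σ) (by simp) (by simp)
  rw [← Finset.sum_const, ← Finset.sum_congr rfl htrans, Finset.sum_comm]
  simp only [hreindex, Finset.sum_const, Finset.card_univ, Fintype.card_perm]

/-- The sum of `f j ∏_{x ≠ j, l} g x` over the ordered pairs of distinct indices `(j, l)`, to which
`ψ` is proportional. -/
def pairSum {n : ℕ} (g f : Fin n → ℝ) : ℝ :=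
  ∑ y ∈ (Finset.univ : Finset (Fin n)).offDiag, f y.1 * ∏ x with x ≠ y.1 ∧ x ≠ y.2, g x

theorem psi_eq_factorial_mul_pairSum {m : ℕ} (g f : Fin (m + 2) → ℝ) :
    psi g f = m ! * pairSum g f := by
  have hterm (σ : Equiv.Perm (Fin (m + 2))) :
      ∏ x with x ≠ σ (Fin.natAdd m 0) ∧ x ≠ σ (Fin.natAdd m 1), g x =
        ∏ i : Fin m, g (σ (Fin.castAdd 2 i)) := by
    rw [Finset.prod_filter, ← Equiv.prod_comp σ, Fin.prod_univ_add, Fin.prod_univ_two]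
    simp [Fin.ext_iff, Fin.val_natAdd, Fin.is_lt, ne_of_lt]
  have hpsi : psi g f = ∑ σ : Equiv.Perm (Fin (m + 2)), f (σ (Fin.natAdd m 0)) *
      ∏ x with x ≠ σ (Fin.natAdd m 0) ∧ x ≠ σ (Fin.natAdd m 1), g x := by
    simp only [hterm, psi, mul_comm]
  have hsum := offDiag_card_nsmul_sum_perm
    (fun j l : Fin (m + 2) => f j * ∏ x with x ≠ j ∧ x ≠ l, g x)
    (a := Fin.natAdd m 0) (b := Fin.natAdd m 1) (by simp [Fin.ext_iff])
  have hcard : (Finset.univ : Finset (Fin (m + 2))).offDiag.card = (m + 2) * (m + 1) := by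
    rw [Finset.offDiag_card, Finset.card_univ, Fintype.card_fin, ← Nat.mul_sub_one]
    rfl
  rw [← hpsi, hcard, Fintype.card_fin, Nat.factorial_succ, Nat.factorial_succ, ← mul_assoc,
    mul_smul _ (m !) (_ : ℝ), smul_right_inj (by positivity), nsmul_eq_mul] at hsum
  exact hsum

theorem bigPsi_eq_factorial_mul {m : ℕ} (p q : Fin (m + 2) → ℝ) :
    bigPsi p q = m ! * (pairSum p q + pairSum q p) := by
  rw [bigPsi, psi_eq_factorial_mul_pairSum, psi_eq_factorial_mul_pairSum, mul_add]

theorem pairSum_eq_sum_sum {n : ℕ} (g f : Fin n → ℝ) :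
    pairSum g f = ∑ j, ∑ l with l ≠ j, f j * ∏ x with x ≠ j ∧ x ≠ l, g x :=
  Finset.sum_finset_product _ Finset.univ (fun j => {l | l ≠ j}) (by simp [eq_comm])

theorem pairSum_five (g f : Fin 5 → ℝ) : pairSum g f =
    f 0 * (g 1 * g 2 * g 3 + g 1 * g 2 * g 4 + g 1 * g 3 * g 4 + g 2 * g 3 * g 4) +
    f 1 * (g 0 * g 2 * g 3 + g 0 * g 2 * g 4 + g 0 * g 3 * g 4 + g 2 * g 3 * g 4) +
    f 2 * (g 0 * g 1 * g 3 + g 0 * g 1 * g 4 + g 0 * g 3 * g 4 + g 1 * g 3 * g 4) +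
    f 3 * (g 0 * g 1 * g 2 + g 0 * g 1 * g 4 + g 0 * g 2 * g 4 + g 1 * g 2 * g 4) +
    f 4 * (g 0 * g 1 * g 2 + g 0 * g 1 * g 3 + g 0 * g 2 * g 3 + g 1 * g 2 * g 3) := by
  simp only [pairSum_eq_sum_sum, Finset.sum_filter, Finset.prod_filter, Fin.sum_univ_five,
    Fin.prod_univ_five, ne_eq, Fin.reduceEq, not_true_eq_false, not_false_eq_true,
    and_true, and_false, if_true, if_false, one_mul, mul_one]
  ring

theorem pairSum_six (g f : Fin 6 → ℝ) : pairSum g f =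
    f 0 * (g 1 * g 2 * g 3 * g 4 + g 1 * g 2 * g 3 * g 5 + g 1 * g 2 * g 4 * g 5 +
      g 1 * g 3 * g 4 * g 5 + g 2 * g 3 * g 4 * g 5) +
    f 1 * (g 0 * g 2 * g 3 * g 4 + g 0 * g 2 * g 3 * g 5 + g 0 * g 2 * g 4 * g 5 +
      g 0 * g 3 * g 4 * g 5 + g 2 * g 3 * g 4 * g 5) +
    f 2 * (g 0 * g 1 * g 3 * g 4 + g 0 * g 1 * g 3 * g 5 + g 0 * g 1 * g 4 * g 5 +
      g 0 * g 3 * g 4 * g 5 + g 1 * g 3 * g 4 * g 5) +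
    f 3 * (g 0 * g 1 * g 2 * g 4 + g 0 * g 1 * g 2 * g 5 + g 0 * g 1 * g 4 * g 5 +
      g 0 * g 2 * g 4 * g 5 + g 1 * g 2 * g 4 * g 5) +
    f 4 * (g 0 * g 1 * g 2 * g 3 + g 0 * g 1 * g 2 * g 5 + g 0 * g 1 * g 3 * g 5 +
      g 0 * g 2 * g 3 * g 5 + g 1 * g 2 * g 3 * g 5) +
    f 5 * (g 0 * g 1 * g 2 * g 3 + g 0 * g 1 * g 2 * g 4 + g 0 * g 1 * g 3 * g 4 +
      g 0 * g 2 * g 3 * g 4 + g 1 * g 2 * g 3 * g 4) := by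
  simp only [pairSum_eq_sum_sum, Finset.sum_filter, Finset.prod_filter, Fin.sum_univ_six,
    Fin.prod_univ_six, ne_eq, Fin.reduceEq, not_true_eq_false, not_false_eq_true,
    and_true, and_false, if_true, if_false, one_mul, mul_one]
  ring

end PairSum

section StepVec

theorem psi_comp_perm {m : ℕ} (g f : Fin (m + 2) → ℝ) (τ : Equiv.Perm (Fin (m + 2))) :
    psi (g ∘ τ) (f ∘ τ) = psi g f :=
  Equiv.sum_comp (Equiv.mulLeft τ) fun σ : Equiv.Perm (Fin (m + 2)) =>
    (∏ i : Fin m, g (σ (Fin.castAdd 2 i))) * f (σ (Fin.natAdd m 0))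

theorem bigPsi_comp_perm {m : ℕ} (p q : Fin (m + 2) → ℝ) (τ : Equiv.Perm (Fin (m + 2))) :
    bigPsi (p ∘ τ) (q ∘ τ) = bigPsi p q := by
  rw [bigPsi, bigPsi, psi_comp_perm, psi_comp_perm]

theorem CoordBalanced.symm {ι : Type*} {p q : ι → ℝ} (h : CoordBalanced p q) :
    CoordBalanced q p := fun i j =>
  (h i j).imp And.symm fun hij => ⟨by rw [mul_comm]; exact hij.1, by tauto⟩

theorem CoordBalanced.le_of_le {ι : Type*} {p q : ι → ℝ} (h : CoordBalanced p q) {i j : ι}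
    (hij : p i ≤ p j) : q j ≤ q i := by
  rcases h i j with ⟨-, hq⟩ | ⟨hlt, -⟩
  · exact hq.ge
  · exact (sub_pos.1 (pos_of_mul_neg_right hlt (sub_nonpos.2 hij))).le

theorem CoordBalanced.exists_forall_le_eq_of_eq_zero {ι : Type*} [Finite ι] [Nonempty ι]
    {p q : ι → ℝ} (hq : ∀ i, 0 ≤ q i) (h : CoordBalanced p q) :
    ∃ u, (∀ i, p i ≤ u) ∧ ∀ i, q i = 0 → p i = u := by
  obtain ⟨k, hk⟩ := Finite.exists_max p
  exact ⟨p k, hk, fun i hi => (hk i).antisymm (h.symm.le_of_le (hi.trans_le (hq k)))⟩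

theorem CoordBalanced.exists_values {ι : Type*} [Finite ι] [Nonempty ι] {p q : ι → ℝ}
    (hp : ∀ i, 0 ≤ p i) (hq : ∀ i, 0 ≤ q i) (h : CoordBalanced p q) :
    ∃ u v w z : ℝ, 0 ≤ w ∧ w ≤ u ∧ 0 ≤ z ∧ z ≤ v ∧ (∀ i, p i = 0 → q i = v) ∧
      (∀ i, q i = 0 → p i = u) ∧ ∀ i, p i ≠ 0 → q i ≠ 0 → p i = w ∧ q i = z := by
  obtain ⟨u, hpu, hu⟩ := h.exists_forall_le_eq_of_eq_zero hq
  obtain ⟨v, hqv, hv⟩ := h.symm.exists_forall_le_eq_of_eq_zero hp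
  by_cases hmid : ∃ c, p c ≠ 0 ∧ q c ≠ 0
  · obtain ⟨c, hpc, hqc⟩ := hmid
    exact ⟨u, v, p c, q c, hp c, hpu c, hq c, hqv c, hv, hu, fun i hpi hqi =>
      (h i c).resolve_right (by tauto)⟩
  · push Not at hmid
    obtain ⟨i⟩ := ‹Nonempty ι›
    exact ⟨u, v, 0, 0, le_rfl, (hp i).trans (hpu i), le_rfl, (hq i).trans (hqv i), hv, hu,
      fun j hpj hqj => absurd (hmid j hpj) hqj⟩

theorem exists_lt_iff_eq_zero_of_monotone {n : ℕ} {r : Fin n → ℝ} (hr : Monotone r)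
    (hr0 : ∀ i, 0 ≤ r i) : ∃ a ≤ n, ∀ i : Fin n, (i : ℕ) < a ↔ r i = 0 := by
  refine ⟨Finset.card {i | r i ≤ 0}, (Finset.card_le_univ _).trans_eq (Fintype.card_fin n),
    fun i => ?_⟩
  rw [Tuple.lt_card_le_iff_apply_le_of_monotone hr, (hr0 i).ge_iff_eq']

theorem exists_le_add_iff_eq_zero_of_antitone {n : ℕ} {r : Fin n → ℝ} (hr : Antitone r)
    (hr0 : ∀ i, 0 ≤ r i) : ∃ b ≤ n, ∀ i : Fin n, n ≤ i + b ↔ r i = 0 := by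
  obtain ⟨b, hb, hrb⟩ :=
    exists_lt_iff_eq_zero_of_monotone (hr.comp Fin.rev_anti) fun i => hr0 i.rev
  refine ⟨b, hb, fun i => ?_⟩
  have := hrb i.rev
  rw [Function.comp_apply, Fin.rev_rev, Fin.val_rev] at this
  rw [← this]
  omega

/-- The vector of length `n` whose first `a` entries are `x`, whose last `b` entries are `z`, and
whose remaining entries are `y`. -/
def stepVec (n a b : ℕ) (x y z : ℝ) : Fin n → ℝ := fun i =>
  if (i : ℕ) < a then x else if i + b < n then y else z

theorem stepVec_comp_rev {n a b : ℕ} (hab : a + b ≤ n) (x y z : ℝ) :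
    stepVec n a b x y z ∘ Fin.revPerm = stepVec n b a z y x := by
  ext i
  simp only [stepVec, Function.comp_apply, Fin.revPerm_apply, Fin.val_rev]
  split_ifs <;> first | rfl | omega

theorem CoordBalanced.exists_comp_perm_eq_stepVec {n : ℕ} {p q : Fin n → ℝ}
    (hp : p ∈ stdSimplex ℝ (Fin n)) (hq : q ∈ stdSimplex ℝ (Fin n)) (h : CoordBalanced p q) :
    ∃ (τ : Equiv.Perm (Fin n)) (a b : ℕ) (u v w z : ℝ), a + b ≤ n ∧ 0 ≤ w ∧ w ≤ u ∧ 0 ≤ z ∧ z ≤ v ∧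
      p ∘ τ = stepVec n a b 0 w u ∧ q ∘ τ = stepVec n a b v z 0 := by
  have : Nonempty (Fin n) := by
    by_contra hempty
    rw [not_nonempty_iff] at hempty
    simpa using hp.2
  obtain ⟨u, v, w, z, hw, hwu, hz, hzv, hv, hu, hwz⟩ := h.exists_values hp.1 hq.1
  let τ := Tuple.sort p
  have hmono : Monotone (p ∘ τ) := Tuple.monotone_sort p
  have hanti : Antitone (q ∘ τ) := fun i j hij => h.le_of_le (hmono hij)
  obtain ⟨a, ha, hpa⟩ := exists_lt_iff_eq_zero_of_monotone hmono fun i => hp.1 (τ i)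
  obtain ⟨b, hb, hqb⟩ := exists_le_add_iff_eq_zero_of_antitone hanti fun i => hq.1 (τ i)
  have hdisj (i : Fin n) (hpi : p i = 0) (hqi : q i = 0) : False := by
    have hq0 (j : Fin n) : q j = 0 :=
      ((h.le_of_le (hpi.trans_le (hp.1 j))).trans_eq hqi).antisymm (hq.1 j)
    simpa [hq0] using hq.2
  refine ⟨τ, a, b, u, v, w, z, ?_, hw, hwu, hz, hzv, ?_, ?_⟩
  · by_contra! hab
    let i : Fin n := ⟨a - 1, by omega⟩
    exact hdisj (τ i) ((hpa i).1 (by simp only [i]; omega)) ((hqb i).1 (by simp only [i]; omega))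
  all_goals
    ext i
    have hpi : (i : ℕ) < a ↔ p (τ i) = 0 := hpa i
    have hqi : i + b < n ↔ q (τ i) ≠ 0 := by rw [← not_le]; exact (hqb i).not
    simp only [stepVec, Function.comp_apply, hpi, hqi]
    split_ifs with h0 h1
  · exact h0
  · exact (hwz _ h0 h1).1
  · exact hu _ (not_not.1 h1)
  · exact hv _ h0
  · exact (hwz _ h0 h1).2
  · exact not_not.1 h1

theorem bigPsi_le_of_stepVec_le {m : ℕ} {M : ℝ}
    (hM : ∀ (a b : ℕ) (u v w z : ℝ), b ≤ a → a + b ≤ m + 2 →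
      0 ≤ w → w ≤ u → 0 ≤ z → z ≤ v →
      ∑ i, stepVec (m + 2) a b 0 w u i = 1 → ∑ i, stepVec (m + 2) a b v z 0 i = 1 →
      bigPsi (stepVec (m + 2) a b 0 w u) (stepVec (m + 2) a b v z 0) ≤ M)
    {p q : Fin (m + 2) → ℝ} (hp : p ∈ stdSimplex ℝ (Fin (m + 2)))
    (hq : q ∈ stdSimplex ℝ (Fin (m + 2))) : bigPsi p q ≤ M := by
  obtain ⟨p₀, hp₀, q₀, hq₀, hbal, hmax⟩ := exists_isMaxOn_bigPsi_coordBalanced m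
  refine (isMaxOn_iff.1 hmax (p, q) ⟨hp, hq⟩).trans ?_
  obtain ⟨τ, a, b, u, v, w, z, hab, hw, hwu, hz, hzv, hpτ, hqτ⟩ :=
    hbal.exists_comp_perm_eq_stepVec hp₀ hq₀
  have hp₁ := comp_perm_mem_stdSimplex hp₀ τ
  have hq₁ := comp_perm_mem_stdSimplex hq₀ τ
  rw [← bigPsi_comp_perm p₀ q₀ τ]
  rcases le_total b a with hba | hba
  · rw [hpτ] at hp₁ ⊢
    rw [hqτ] at hq₁ ⊢
    exact hM a b u v w z hba hab hw hwu hz hzv hp₁.2 hq₁.2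
  · have hp₂ := comp_perm_mem_stdSimplex hp₁ Fin.revPerm
    have hq₂ := comp_perm_mem_stdSimplex hq₁ Fin.revPerm
    rw [bigPsi_comm, ← bigPsi_comp_perm _ _ Fin.revPerm]
    rw [hpτ, stepVec_comp_rev hab] at hp₂ ⊢
    rw [hqτ, stepVec_comp_rev hab] at hq₂ ⊢
    exact hM b a v u z w hba (by omega) hz hzv hw hwu hq₂.2 hp₂.2

end StepVec

section StepVecBounds

variable {w t z s : ℝ}

/-- The homogeneous form of the gap in `pairSum p q + pairSum q p ≤ C` for vectors `p`, `q` with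
sum `1`; it is a form of degree `k + 1` in each vector when these have length `k + 3`. -/
def pairSumGap {n : ℕ} (C : ℝ) (k : ℕ) (p q : Fin n → ℝ) : ℝ :=
  C * (∑ i, p i) ^ (k + 1) * (∑ i, q i) ^ (k + 1) -
    (pairSum p q * (∑ i, q i) ^ k + pairSum q p * (∑ i, p i) ^ k)

-- `81 / 1250` is slightly less than `(15 * (48 + √5) / 1936) / 3!`.
theorem pairSumGap_stepVec_five_one_one_nonneg (hw : 0 ≤ w) (ht : 0 ≤ t) (hz : 0 ≤ z)
    (hs : 0 ≤ s) :
    0 ≤ pairSumGap (81 / 1250) 2 (stepVec 5 1 1 0 w (w + t)) (stepVec 5 1 1 (z + s) z 0) := by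
  have hcert : 0 ≤ w * z * (9 * (w * z - t * s) ^ 2 + 6 * (2 * (w * z) - t * z - w * s) ^ 2 +
      47 / 10 * (t * z - w * s) ^ 2 + 7 * (t * w * (s - z) ^ 2 + s * z * (t - w) ^ 2)) := by
    positivity
  -- The gap exceeds this certificate by a polynomial with nonnegative coefficients.
  refine hcert.trans (sub_nonneg.1 ?_)
  simp only [pairSumGap, pairSum_five, Fin.sum_univ_five, stepVec, Fin.coe_ofNat_eq_mod,
    Nat.reduceMod, Nat.reduceAdd, Nat.reduceLT, if_true, if_false]
  ring_nf
  positivity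

theorem pairSumGap_stepVec_five_two_one_nonneg (hw : 0 ≤ w) (ht : 0 ≤ t) (hz : 0 ≤ z)
    (hs : 0 ≤ s) :
    0 ≤ pairSumGap (81 / 1250) 2 (stepVec 5 2 1 0 w (w + t)) (stepVec 5 2 1 (z + s) z 0) := by
  have hcert : 0 ≤ 6 * (w * z ^ 2 * s * (t - w) ^ 2) := by positivity
  refine hcert.trans (sub_nonneg.1 ?_)
  simp only [pairSumGap, pairSum_five, Fin.sum_univ_five, stepVec, Fin.coe_ofNat_eq_mod,
    Nat.reduceMod, Nat.reduceAdd, Nat.reduceLT, if_true, if_false]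
  ring_nf
  positivity

theorem pairSumGap_stepVec_five_nonneg {a b : ℕ} (hba : b ≤ a) (hab : a + b ≤ 5)
    (h10 : ¬(a = 1 ∧ b = 0)) (hw : 0 ≤ w) (ht : 0 ≤ t) (hz : 0 ≤ z) (hs : 0 ≤ s) :
    0 ≤ pairSumGap (81 / 1250) 2 (stepVec 5 a b 0 w (w + t)) (stepVec 5 a b (z + s) z 0) := by
  have ha : a ≤ 5 := by omega
  by_cases h11 : a = 1 ∧ b = 1
  · obtain ⟨rfl, rfl⟩ := h11
    exact pairSumGap_stepVec_five_one_one_nonneg hw ht hz hs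
  by_cases h21 : a = 2 ∧ b = 1
  · obtain ⟨rfl, rfl⟩ := h21
    exact pairSumGap_stepVec_five_two_one_nonneg hw ht hz hs
  interval_cases a <;> interval_cases b <;> try omega
  all_goals
    simp only [pairSumGap, pairSum_five, Fin.sum_univ_five, stepVec, Fin.coe_ofNat_eq_mod,
      Nat.reduceMod, Nat.reduceAdd, Nat.reduceLT, if_true, if_false]
    ring_nf
    positivity

theorem pairSumGap_stepVec_six_one_zero_nonneg (hz : 0 ≤ z) (hs : 0 ≤ s) :
    0 ≤ pairSumGap (1 / 125) 3 (stepVec 6 1 0 0 w (w + t)) (stepVec 6 1 0 (z + s) z 0) := by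
  have hcert : 0 ≤ 180 * (w ^ 4 * z ^ 2 * (s - z) ^ 2) := by positivity
  refine hcert.trans (sub_nonneg.1 ?_)
  simp only [pairSumGap, pairSum_six, Fin.sum_univ_six, stepVec, Fin.coe_ofNat_eq_mod,
    Nat.reduceMod, Nat.reduceAdd, Nat.reduceLT, if_true, if_false]
  ring_nf
  positivity

theorem pairSumGap_stepVec_six_one_one_nonneg (hw : 0 ≤ w) (ht : 0 ≤ t) (hz : 0 ≤ z)
    (hs : 0 ≤ s) :
    0 ≤ pairSumGap (1 / 125) 3 (stepVec 6 1 1 0 w (w + t)) (stepVec 6 1 1 (z + s) z 0) := by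
  have hcert : 0 ≤ 110 * (w ^ 2 * z ^ 3 * s * (t - w) ^ 2) := by positivity
  refine hcert.trans (sub_nonneg.1 ?_)
  simp only [pairSumGap, pairSum_six, Fin.sum_univ_six, stepVec, Fin.coe_ofNat_eq_mod,
    Nat.reduceMod, Nat.reduceAdd, Nat.reduceLT, if_true, if_false]
  ring_nf
  positivity

theorem pairSumGap_stepVec_six_nonneg {a b : ℕ} (hba : b ≤ a) (hab : a + b ≤ 6)
    (hw : 0 ≤ w) (ht : 0 ≤ t) (hz : 0 ≤ z) (hs : 0 ≤ s) :
    0 ≤ pairSumGap (1 / 125) 3 (stepVec 6 a b 0 w (w + t)) (stepVec 6 a b (z + s) z 0) := by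
  have ha : a ≤ 6 := by omega
  by_cases h10 : a = 1 ∧ b = 0
  · obtain ⟨rfl, rfl⟩ := h10
    exact pairSumGap_stepVec_six_one_zero_nonneg hz hs
  by_cases h11 : a = 1 ∧ b = 1
  · obtain ⟨rfl, rfl⟩ := h11
    exact pairSumGap_stepVec_six_one_one_nonneg hw ht hz hs
  interval_cases a <;> interval_cases b <;> try omega
  all_goals
    simp only [pairSumGap, pairSum_six, Fin.sum_univ_six, stepVec, Fin.coe_ofNat_eq_mod,
      Nat.reduceMod, Nat.reduceAdd, Nat.reduceLT, if_true, if_false]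
    ring_nf
    positivity

open scoped Nat in
theorem bigPsi_le_of_pairSumGap_nonneg {m : ℕ} {C : ℝ} {k : ℕ} {p q : Fin (m + 2) → ℝ}
    (hp : ∑ i, p i = 1) (hq : ∑ i, q i = 1) (h : 0 ≤ pairSumGap C k p q) :
    bigPsi p q ≤ m ! * C := by
  simp only [pairSumGap, hp, hq, one_pow, mul_one, sub_nonneg] at h
  rw [bigPsi_eq_factorial_mul]
  gcongr

end StepVecBounds

theorem stepVec_five_one_zero (x y z : ℝ) : stepVec 5 1 0 x y z = ![x, y, y, y, y] := by
  ext i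
  fin_cases i <;> rfl

theorem bigPsi_quarter_eq (x : ℝ) :
    bigPsi (m := 3) ![0, 1 / 4, 1 / 4, 1 / 4, 1 / 4] ![1 - 4 * x, x, x, x, x] =
      15 * (48 + √5) / 1936 - 66 * ((x - (4 + √5) / 44) ^ 2 * (x + (√5 - 2) / 22)) := by
  have hsqrt : √5 ^ 2 = 5 := Real.sq_sqrt (by norm_num)
  have hfactorial : ((Nat.factorial 3 : ℕ) : ℝ) = 6 := by norm_num
  rw [bigPsi_eq_factorial_mul, pairSum_five, pairSum_five, hfactorial]
  simp only [Matrix.cons_val]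
  linear_combination (-198 / 1936 * x + 3 * (√5 + 6) / 1936) * hsqrt

theorem bigPsi_five_le {p q : Fin (3 + 2) → ℝ} (hp : p ∈ stdSimplex ℝ (Fin (3 + 2)))
    (hq : q ∈ stdSimplex ℝ (Fin (3 + 2))) : bigPsi p q ≤ 15 * (48 + √5) / 1936 := by
  have hsqrt : 22 / 10 ≤ √5 := Real.le_sqrt_of_sq_le (by norm_num)
  refine bigPsi_le_of_stepVec_le (fun a b u v w z hba hab hw hwu hz hzv hp hq => ?_) hp hq
  by_cases h10 : a = 1 ∧ b = 0
  · obtain ⟨rfl, rfl⟩ := h10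
    simp only [Nat.reduceAdd, stepVec_five_one_zero, Fin.sum_univ_five, Matrix.cons_val] at hp hq ⊢
    obtain rfl : w = 1 / 4 := by linarith
    obtain rfl : v = 1 - 4 * z := by linarith
    rw [bigPsi_quarter_eq, sub_le_self_iff]
    have : 0 ≤ z + (√5 - 2) / 22 := by linarith
    positivity
  · obtain ⟨t, rfl⟩ := exists_add_of_le hwu
    obtain ⟨s, rfl⟩ := exists_add_of_le hzv
    refine (bigPsi_le_of_pairSumGap_nonneg hp hq (pairSumGap_stepVec_five_nonneg hba hab h10 hw
      (nonneg_of_le_add_right hwu) hz (nonneg_of_le_add_right hzv))).trans ?_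
    rw [show ((Nat.factorial 3 : ℕ) : ℝ) = 6 by norm_num]
    linarith

theorem bigPsi_six_le {p q : Fin (4 + 2) → ℝ} (hp : p ∈ stdSimplex ℝ (Fin (4 + 2)))
    (hq : q ∈ stdSimplex ℝ (Fin (4 + 2))) : bigPsi p q ≤ 24 / 125 := by
  refine bigPsi_le_of_stepVec_le (fun a b u v w z hba hab hw hwu hz hzv hp hq => ?_) hp hq
  obtain ⟨t, rfl⟩ := exists_add_of_le hwu
  obtain ⟨s, rfl⟩ := exists_add_of_le hzv
  refine (bigPsi_le_of_pairSumGap_nonneg hp hq (pairSumGap_stepVec_six_nonneg hba hab hw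
    (nonneg_of_le_add_right hwu) hz (nonneg_of_le_add_right hzv))).trans_eq ?_
  norm_num

theorem mem_stdSimplex_of_forall_succ_eq {n : ℕ} {r : Fin (n + 1) → ℝ} {y : ℝ} (hr₀ : 0 ≤ r 0)
    (hy : 0 ≤ y) (hr : ∀ i : Fin n, r i.succ = y) (hsum : r 0 + n * y = 1) :
    r ∈ stdSimplex ℝ (Fin (n + 1)) :=
  ⟨Fin.cases hr₀ fun i => (hr i).symm ▸ hy, by simpa [Fin.sum_univ_succ, hr] using hsum⟩

theorem bigPsi_one_fifth_eq :
    bigPsi (m := 4) ![1, 0, 0, 0, 0, 0] ![0, 1 / 5, 1 / 5, 1 / 5, 1 / 5, 1 / 5] = 24 / 125 := by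
  rw [bigPsi_eq_factorial_mul, pairSum_six, pairSum_six]
  simp only [Matrix.cons_val]
  norm_num

theorem abs_fifteen_mul_div_sub_lt : |15 * (48 + √5) / 1936 - 0.389226| < 0.0000005 := by
  have hlow : 2.23606 < √5 := Real.lt_sqrt_of_sq_lt (by norm_num)
  have hupp : √5 < 2.23607 := (Real.sqrt_lt' (by norm_num)).2 (by norm_num)
  rw [abs_lt]
  constructor <;> linarith

theorem mainTheorem2 (δ γ : ℝ) (hδ : δ = (4 + √5) / 44) (hγ : γ = 1 - 4 * δ) :
    -- `k = 5`
    (IsGreatest (bigPsiValues 3) (15 * (48 + √5) / 1936) ∧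
      |15 * (48 + √5) / 1936 - 0.389226| < 0.0000005 ∧
      ![0, 1 / 4, 1 / 4, 1 / 4, 1 / 4] ∈ stdSimplex ℝ (Fin 5) ∧
      ![γ, δ, δ, δ, δ] ∈ stdSimplex ℝ (Fin 5) ∧
      bigPsi (m := 3) ![0, 1 / 4, 1 / 4, 1 / 4, 1 / 4] ![γ, δ, δ, δ, δ]
        = 15 * (48 + √5) / 1936) ∧
    -- `k = 6`
    (IsGreatest (bigPsiValues 4) (24 / 125) ∧
      ![1, 0, 0, 0, 0, 0] ∈ stdSimplex ℝ (Fin 6) ∧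
      ![0, 1 / 5, 1 / 5, 1 / 5, 1 / 5, 1 / 5] ∈ stdSimplex ℝ (Fin 6) ∧
      bigPsi (m := 4) ![1, 0, 0, 0, 0, 0] ![0, 1 / 5, 1 / 5, 1 / 5, 1 / 5, 1 / 5]
        = 24 / 125) := by
  have hδ₀ : 0 ≤ δ := by rw [hδ]; positivity
  have hγ₀ : 0 ≤ γ := by linarith [show √5 ≤ 7 from Real.sqrt_le_iff.2 (by norm_num)]
  have hp₅ : ![0, 1 / 4, 1 / 4, 1 / 4, 1 / 4] ∈ stdSimplex ℝ (Fin 5) :=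
    mem_stdSimplex_of_forall_succ_eq (y := 1 / 4) le_rfl (by norm_num)
      (by simp [Fin.forall_fin_succ]) (by norm_num)
  have hq₅ : ![γ, δ, δ, δ, δ] ∈ stdSimplex ℝ (Fin 5) :=
    mem_stdSimplex_of_forall_succ_eq hγ₀ hδ₀ (by simp [Fin.forall_fin_succ]) (by simp [hγ])
  have hval₅ : bigPsi (m := 3) ![0, 1 / 4, 1 / 4, 1 / 4, 1 / 4] ![γ, δ, δ, δ, δ] =
      15 * (48 + √5) / 1936 := by
    rw [hγ, bigPsi_quarter_eq, ← hδ]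
    ring
  have hp₆ : ![1, 0, 0, 0, 0, 0] ∈ stdSimplex ℝ (Fin 6) :=
    mem_stdSimplex_of_forall_succ_eq (y := 0) zero_le_one le_rfl
      (by simp [Fin.forall_fin_succ]) (by norm_num)
  have hq₆ : ![0, 1 / 5, 1 / 5, 1 / 5, 1 / 5, 1 / 5] ∈ stdSimplex ℝ (Fin 6) :=
    mem_stdSimplex_of_forall_succ_eq (y := 1 / 5) le_rfl (by norm_num)
      (by simp [Fin.forall_fin_succ]) (by norm_num)
  refine ⟨⟨⟨⟨_, hp₅, _, hq₅, hval₅⟩, ?_⟩, abs_fifteen_mul_div_sub_lt, hp₅, hq₅, hval₅⟩,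
    ⟨⟨_, hp₆, _, hq₆, bigPsi_one_fifth_eq⟩, ?_⟩, hp₆, hq₆, bigPsi_one_fifth_eq⟩
  · rintro _ ⟨p, hp, q, hq, rfl⟩
    exact bigPsi_five_le hp hq
  · rintro _ ⟨p, hp, q, hq, rfl⟩
    exact bigPsi_six_le hp hq
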